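/- **Setting.** Let $\mathbb X=(X_n)_{n\ge1}$ be a strictly stationary sequence of (real) random variables on a probability space $(\Omega,\mathcal F,\mathbb P)$, let $a>0$ be a real number, and let $(k_n)_{n\ge1}$ be integers with $1\le k_n\le n$ for all $n\ge 1$ and $k_n/n\to1$ as $n\to\infty$. Write $X_{1:n}\le\dots\le X_{n:n}$ for the order statistics of $X_1,\dots,X_n$, and $I(\cdot)$ for indicators. Let $\mathcal I^{\mathbb X}$ be the sigma-field of all sets $A\subset\Omega$ for which there is a Borel set $B\subset\mathbb R^{\mathbb N}$ with $A=\{\omega:(X_i(\omega),X_{i+1}(\omega),\dots)\in B\}$ for every $i\ge1$. For a random variable $Y$ and a sigma-field $\mathcal G\subset\mathcal F$, the conditional right endpoint $\gamma_1(Y|\mathcal G)$ is the (almost surely unique) $\mathcal G$-measurable function $\Omega\to[-\infty,\infty]$ such that $\mathbb P(Y\le\gamma_1(Y|\mathcal G)\,|\,\mathcal G)=1$ a.s. and such that every $\mathcal G$-measurable $Q:\Omega\to[-\infty,\infty]$ with $\mathbb P(Y\le Q\,|\,\mathcal G)=1$ a.s. satisfies $Q\ge\gamma_1(Y|\mathcal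 G)$ a.s. Put $$S(k_n,n,a)=\sum_{i=1}^n X_i\, I(X_{k_n:n}-a<X_i<X_{k_n:n}),$$ and, for a process $(N(t),t\ge0)$ of non-negative integer-valued random variables, $$\mathcal S_t(k_{N(t)},a)=\sum_{i=1}^{N(t)} X_i\, I(X_{k_{N(t)}:N(t)}-a<X_i<X_{k_{N(t)}:N(t)}).$$ **Theorem.** Suppose that $\gamma_1(X_1|\mathcal I^{\mathbb X})=\infty$ a.s. Then, almost surely, $X_{k_n:n}\ne0$ for all sufficiently large $n$, and $$\frac{S(k_n,n,a)}{n\,X_{k_n:n}}\longrightarrow 0\qquad (n\to\infty).$$ Let moreover $(N(t),t\ge0)$ be a process of non-negative integer-valued random variables on $\Omega$, let $Z$ be an almost surely positive (real) random variable on $\Omega$, let $c$ be a positive function on $(0,\infty)$ with $c(t)\to\infty$ as $t\to\infty$, and suppose that $N(t)/c(t)\to Z$ a.s. as $t\to\infty$. Then, almost surely, $N(t)\ge1$ and $X_{k_{N(t)}:N(t)}\ne0$ for all sufficiently large $t$, and $$\frac{\mathcal S_t(k_{N(t)},a)}{c(t)\,X_{k_{N(t)}:N(t)}}\longrightarrow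 0\qquad (t\to\infty).$$ -/

import Mathlib

open MeasureTheory ProbabilityTheory Filter
open scoped Topology NNReal

/-
Sequences are indexed from `0` : the entry `X i` of a sequence `X : ℕ → Ω → ℝ` is the random
variable that is usually called `X_{i+1}`, so that `X_1, …, X_n` are the entries with index in
`Finset.range n`.
-/

namespace NearMax

/-- The `k`-th order statistic `x_{k:n}`, that is the `k`-th smallest value (with repetitions)
among the first `n` entries of `x`, for `1 ≤ k ≤ n`. Outside that range the value is `0`. -/
noncomputable def orderStat (x : ℕ → ℝ) (k n : ℕ) : ℝ :=
  if h : 1 ≤ k ∧ k ≤ n then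
    x (Tuple.sort (fun i : Fin n => x i) ⟨k - 1, by omega⟩ : Fin n)
  else 0

/-- The sum `S(k,n,a)` of those among the first `n` entries of `x` that lie in the open interval
`(x_{k:n} - a, x_{k:n})`. -/
noncomputable def nearSum (x : ℕ → ℝ) (k n : ℕ) (a : ℝ) : ℝ :=
  ∑ i ∈ Finset.range n,
    Set.indicator (Set.Ioo (orderStat x k n - a) (orderStat x k n)) (fun y => y) (x i)

/-- `1 ≤ k_n ≤ n` for all `n ≥ 1`, and `k_n / n → 1`. -/
structure IsExtremeOrIntermediate (k : ℕ → ℕ) : Prop where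
  mem : ∀ n, 1 ≤ n → 1 ≤ k n ∧ k n ≤ n
  tendsto : Tendsto (fun n => (k n : ℝ) / (n : ℝ)) atTop (𝓝 1)

variable {Ω : Type*}

/-- Strict stationarity: all the shifted sequences have the same law on the space of real sequences
with its product (equivalently Borel) sigma-field. -/
def StrictlyStationary {mΩ : MeasurableSpace Ω} (μ : Measure Ω) (X : ℕ → Ω → ℝ) : Prop :=
  ∀ m : ℕ, μ.map (fun ω (i : ℕ) => X (i + m) ω) = μ.map (fun ω (i : ℕ) => X i ω)

/-- The class of the sets that are invariant with respect to the sequence `X`: those sets `A` for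
which there is one Borel set `B` of real sequences with
`A = {ω | (X_i(ω), X_{i+1}(ω), …) ∈ B}` for every `i`. -/
@[reducible] def invariantSigma (X : ℕ → Ω → ℝ) : MeasurableSpace Ω where
  MeasurableSet' A := ∃ B : Set (ℕ → ℝ), MeasurableSet B ∧
    ∀ i : ℕ, A = {ω | (fun j : ℕ => X (i + j) ω) ∈ B}
  measurableSet_empty := ⟨∅, MeasurableSet.empty, fun _ => by ext; simp⟩
  measurableSet_compl := by
    rintro A ⟨B, hB, h⟩
    refine ⟨Bᶜ, hB.compl, fun i => ?_⟩
    rw [h i]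
    rfl
  measurableSet_iUnion := by
    intro A hA
    choose B hB h using hA
    refine ⟨⋃ n, B n, MeasurableSet.iUnion hB, fun i => ?_⟩
    ext ω
    simp only [Set.mem_iUnion, Set.mem_ofPred_eq]
    refine exists_congr fun n => ?_
    rw [h n i]
    rfl

/-- For random variables the invariant sets form a sub-sigma-field of the ambient one. -/
theorem invariantSigma_le {mΩ : MeasurableSpace Ω} {X : ℕ → Ω → ℝ}
    (hX : ∀ i, Measurable (X i)) : invariantSigma X ≤ mΩ := by
  rintro A ⟨B, hB, h⟩
  rw [h 0]
  exact (measurable_pi_lambda _ fun j => hX (0 + j)) hB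

/-- `Q` is (a version of) the conditional right endpoint of the support of `Y` given the
sub-sigma-field `G`: the smallest `G`-measurable extended random variable that bounds `Y` from above
with conditional probability one. -/
structure IsCondRightEndpoint {mΩ : MeasurableSpace Ω} (μ : Measure Ω) (G : MeasurableSpace Ω)
    (Y : Ω → ℝ) (Q : Ω → EReal) : Prop where
  measurable : Measurable[G] Q
  bound : μ⟦{ω | (Y ω : EReal) ≤ Q ω} | G⟧ =ᵐ[μ] fun _ => (1 : ℝ)
  least : ∀ Q' : Ω → EReal, Measurable[G] Q' →
    μ⟦{ω | (Y ω : EReal) ≤ Q' ω} | G⟧ =ᵐ[μ] (fun _ => (1 : ℝ)) → Q ≤ᵐ[μ] Q'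

/-- The standing condition on the claim number process `N`, the random variable `Z` and the
normalizing function `c`. (The value of `c` at time `0` is left free, so that `c(t) = t` is
allowed.) -/
structure ConditionA {mΩ : MeasurableSpace Ω} (μ : Measure Ω) (N : ℝ≥0 → Ω → ℕ) (Z : Ω → ℝ)
    (c : ℝ≥0 → ℝ) : Prop where
  measurable_N : ∀ t, Measurable (N t)
  measurable_Z : Measurable Z
  Z_pos : ∀ᵐ ω ∂μ, 0 < Z ω
  c_pos : ∀ t, 0 < t → 0 < c t
  c_tendsto : Tendsto c atTop atTop

end NearMax

/-!
By the maximal ergodic theorem, a set of small measure is visited with uniformly small frequency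
along most orbits, and almost no point of a set `A` returns to `A` with lower frequency zero.
Applied to the shift and to the sets `{x | v < x 0}`, this shows that the proportion of `X₁, …, Xₙ`
above the level `v` is small uniformly in `n` when `v` is large, and that, for each fixed `v`, it
stays away from zero: the event that it does not is invariant, and on this event `v` bounds `X₁`,
whereas the conditional right endpoint is infinite. Since `kₙ / n → 1`, the second fact makes
`X_{kₙ:n}` tend to infinity. Then the summands of `S(kₙ, n, a)` exceed any given level, and by the
first fact they are few.
-/

namespace NearMax

section MaximalErgodic

variable {α : Type*} {T : α → α} {f : α → ℝ}

theorem partialSups_birkhoffSum_le_max (n : ℕ) (x : α) :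
    partialSups (birkhoffSum T f) n x ≤ max 0 (f x + partialSups (birkhoffSum T f) n (T x)) := by
  rw [Pi.partialSups_apply, partialSups_le_iff]
  rintro (_ | j) hj
  · simp only [birkhoffSum_zero, le_max_left]
  · rw [birkhoffSum_succ']
    refine le_max_of_le_right (add_le_add_right ?_ _)
    exact le_partialSups_of_le (birkhoffSum T f) (j.le_succ.trans hj) (T x)

theorem partialSups_birkhoffSum_nonneg (n : ℕ) (x : α) :
    0 ≤ partialSups (birkhoffSum T f) n x :=
  (birkhoffSum_zero T f x).ge.trans (le_partialSups_of_le (birkhoffSum T f) n.zero_le x)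

theorem iUnion_partialSups_birkhoffSum_pos :
    ⋃ n, {x | 0 < partialSups (birkhoffSum T f) n x} = {x | ∃ n, 0 < birkhoffSum T f n x} := by
  ext x
  simp only [Set.mem_iUnion, Set.mem_ofPred_eq]
  constructor
  · rintro ⟨n, hn⟩
    rw [Pi.partialSups_apply] at hn
    obtain ⟨m, -, hm⟩ := exists_partialSups_eq (fun i => birkhoffSum T f i x) n
    exact ⟨m, hm ▸ hn⟩
  · rintro ⟨n, hn⟩
    exact ⟨n, hn.trans_le (le_partialSups (birkhoffSum T f) n x)⟩

variable [MeasurableSpace α] {ν : Measure α}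

theorem integrable_birkhoffSum (hT : MeasurePreserving T ν ν) (hf : Integrable f ν) (n : ℕ) :
    Integrable (birkhoffSum T f n) ν :=
  integrable_finsetSum _ fun i _ => (hT.iterate i).integrable_comp_of_integrable hf

theorem integrable_partialSups_birkhoffSum (hT : MeasurePreserving T ν ν) (hf : Integrable f ν)
    (n : ℕ) : Integrable (partialSups (birkhoffSum T f) n) ν := by
  induction n with
  | zero => rw [partialSups_zero]; exact integrable_birkhoffSum hT hf 0
  | succ n ih => rw [partialSups_add_one]; exact ih.sup (integrable_birkhoffSum hT hf (n + 1))

theorem setIntegral_partialSups_birkhoffSum_pos_nonneg (hT : MeasurePreserving T ν ν)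
    (hf : Integrable f ν) (n : ℕ) :
    0 ≤ ∫ x in {x | 0 < partialSups (birkhoffSum T f) n x}, f x ∂ν := by
  set M := partialSups (birkhoffSum T f) n
  have hM : Integrable M ν := integrable_partialSups_birkhoffSum hT hf n
  have hMT : Integrable (fun x => M (T x)) ν := hT.integrable_comp_of_integrable hM
  have hE : NullMeasurableSet {x | 0 < M x} ν :=
    nullMeasurableSet_lt aemeasurable_const hM.aemeasurable
  have hle : ∀ x, M x - M (T x) ≤ {x | 0 < M x}.indicator f x := by
    intro x
    have hTx : 0 ≤ M (T x) := partialSups_birkhoffSum_nonneg n (T x)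
    by_cases hx : 0 < M x
    · rw [Set.indicator_of_mem (s := {x | 0 < M x}) hx]
      have hmax : M x ≤ f x + M (T x) :=
        (le_max_iff.1 (partialSups_birkhoffSum_le_max n x)).resolve_left hx.not_ge
      linarith
    · rw [Set.indicator_of_notMem (s := {x | 0 < M x}) hx]
      linarith
  have hinv : ∫ x, M (T x) ∂ν = ∫ x, M x ∂ν := by
    rw [← integral_map hT.aemeasurable (hT.map_eq.symm ▸ hM.aestronglyMeasurable), hT.map_eq]
  calc 0 = ∫ x, (M x - M (T x)) ∂ν := by rw [integral_sub hM hMT, hinv, sub_self]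
    _ ≤ ∫ x, {x | 0 < M x}.indicator f x ∂ν :=
      integral_mono (hM.sub hMT) (hf.indicator₀ hE) hle
    _ = ∫ x in {x | 0 < M x}, f x ∂ν := integral_indicator₀ hE

theorem setIntegral_exists_birkhoffSum_pos_nonneg (hT : MeasurePreserving T ν ν)
    (hf : Integrable f ν) : 0 ≤ ∫ x in {x | ∃ n, 0 < birkhoffSum T f n x}, f x ∂ν := by
  rw [← iUnion_partialSups_birkhoffSum_pos]
  refine ge_of_tendsto' (tendsto_setIntegral_of_monotone₀ (fun n => ?_) ?_ hf.integrableOn)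
    (setIntegral_partialSups_birkhoffSum_pos_nonneg hT hf)
  · exact nullMeasurableSet_lt aemeasurable_const
      (integrable_partialSups_birkhoffSum hT hf n).aemeasurable
  · exact fun m n hmn x hx => lt_of_lt_of_le hx ((partialSups (birkhoffSum T f)).monotone hmn x)

variable [IsFiniteMeasure ν]

theorem mul_measureReal_exists_lt_birkhoffSum_le (hT : MeasurePreserving T ν ν)
    (hf : Integrable f ν) (c : ℝ) :
    c * ν.real {x | ∃ n : ℕ, n * c < birkhoffSum T f n x} ≤
      ∫ x in {x | ∃ n : ℕ, n * c < birkhoffSum T f n x}, f x ∂ν := by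
  have hc : Integrable (fun _ : α => c) ν := integrable_const c
  have h := setIntegral_exists_birkhoffSum_pos_nonneg hT (hf.sub hc)
  have hsum : ∀ n x, birkhoffSum T (f - fun _ => c) n x = birkhoffSum T f n x - n * c := by
    intro n x
    rw [birkhoffSum_sub, birkhoffSum_of_comp_eq (φ := fun _ => c) rfl, Pi.smul_apply,
      nsmul_eq_mul]
  simp only [hsum, sub_pos, Pi.sub_apply] at h
  rw [integral_sub hf.integrableOn hc.integrableOn, setIntegral_const, smul_eq_mul] at h
  linarith

theorem setIntegral_le_mul_measureReal_of_birkhoffSum_lt (hT : MeasurePreserving T ν ν)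
    (hf : Integrable f ν) {B : Set α} (hB : MeasurableSet[MeasurableSpace.invariants T] B) {c : ℝ}
    (h : ∀ x ∈ B, ∃ n : ℕ, birkhoffSum T f n x < n * c) :
    ∫ x in B, f x ∂ν ≤ c * ν.real B := by
  obtain ⟨hBm, hTB⟩ := MeasurableSpace.measurableSet_invariants.1 hB
  have hTB' : MeasurePreserving T (ν.restrict B) (ν.restrict B) := by
    simpa only [hTB] using hT.restrict_preimage hBm
  have hmax := mul_measureReal_exists_lt_birkhoffSum_le hTB' hf.integrableOn.neg (-c)
  set E := {x | ∃ n : ℕ, (n : ℝ) * -c < birkhoffSum T (-f) n x}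
  have hBE : B ⊆ E := fun x hx => (h x hx).imp fun n hn => by
    rw [birkhoffSum_neg]
    linarith
  rw [measureReal_def, Measure.restrict_apply_superset hBE, ← measureReal_def,
    Measure.restrict_restrict' hBm, Set.inter_eq_right.2 hBE] at hmax
  simp only [Pi.neg_apply, integral_neg] at hmax
  linarith

end MaximalErgodic

section Visits

variable {α : Type*} {T : α → α} {A : Set α}

/-- The set of the points whose orbit under `T` visits `A` with lower asymptotic frequency zero. -/
def rarelyVisiting (T : α → α) (A : Set α) : Set α :=
  {x | ∀ ε > 0, ∃ᶠ n in atTop, birkhoffAverage ℝ T (A.indicator (1 : α → ℝ)) n x < ε}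

theorem exists_eventually_le_birkhoffSum_of_notMem_rarelyVisiting {x : α}
    (hx : x ∉ rarelyVisiting T A) :
    ∃ ε > (0 : ℝ), ∀ᶠ n : ℕ in atTop, n * ε ≤ birkhoffSum T (A.indicator (1 : α → ℝ)) n x := by
  simp only [rarelyVisiting, Set.mem_ofPred_eq, not_forall, not_frequently, not_lt] at hx
  obtain ⟨ε, hε, h⟩ := hx
  refine ⟨ε, hε, ?_⟩
  filter_upwards [h, eventually_gt_atTop 0] with n hn hn0
  rwa [birkhoffAverage, smul_eq_mul, le_inv_mul_iff₀ (Nat.cast_pos.2 hn0)] at hn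

theorem mem_rarelyVisiting_of_tendsto_sub {x y : α} (hx : x ∈ rarelyVisiting T A)
    (h : Tendsto (fun n => birkhoffAverage ℝ T (A.indicator (1 : α → ℝ)) n y -
      birkhoffAverage ℝ T (A.indicator (1 : α → ℝ)) n x) atTop (𝓝 0)) : y ∈ rarelyVisiting T A := by
  intro ε hε
  refine ((hx _ (half_pos hε)).and_eventually (h.eventually_lt_const (half_pos hε))).mono ?_
  rintro n ⟨hn, hn'⟩
  linarith

theorem preimage_rarelyVisiting : T ⁻¹' rarelyVisiting T A = rarelyVisiting T A := by
  have hbdd : Bornology.IsBounded (Set.range (A.indicator (1 : α → ℝ))) :=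
    (Set.toFinite {0, 1}).isBounded.subset <| Set.range_subset_iff.2 fun x => by
      by_cases hx : x ∈ A <;> simp [hx]
  have h := tendsto_birkhoffAverage_apply_sub_birkhoffAverage' ℝ hbdd T
  ext x
  rw [Set.mem_preimage]
  refine ⟨fun hx => mem_rarelyVisiting_of_tendsto_sub hx ?_,
    fun hx => mem_rarelyVisiting_of_tendsto_sub hx (h x)⟩
  simpa only [neg_sub, neg_zero] using (h x).neg

variable [MeasurableSpace α]

theorem measurable_birkhoffAverage {f : α → ℝ} (hT : Measurable T) (hf : Measurable f) (n : ℕ) :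
    Measurable (birkhoffAverage ℝ T f n) :=
  (Finset.measurable_fun_sum _ fun i _ => hf.comp (hT.iterate i)).const_smul (n : ℝ)⁻¹

theorem measurableSet_rarelyVisiting (hT : Measurable T) (hA : MeasurableSet A) :
    MeasurableSet (rarelyVisiting T A) := by
  have h : rarelyVisiting T A = ⋂ m : ℕ, limsup
      (fun n => {x | birkhoffAverage ℝ T (A.indicator (1 : α → ℝ)) n x < 1 / ((m : ℝ) + 1)})
      atTop := by
    ext x
    simp only [Set.mem_iInter, mem_limsup_iff_frequently_mem, Set.mem_ofPred_eq]
    refine ⟨fun hx m => hx _ Nat.one_div_pos_of_nat, fun hx ε hε => ?_⟩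
    obtain ⟨m, hm⟩ := exists_nat_one_div_lt hε
    exact (hx m).mono fun n hn => hn.trans hm
  rw [h]
  exact .iInter fun m => .measurableSet_limsup fun n =>
    measurableSet_lt (measurable_birkhoffAverage hT (measurable_one.indicator hA) n)
      measurable_const

theorem measurableSet_invariants_rarelyVisiting (hT : Measurable T) (hA : MeasurableSet A) :
    MeasurableSet[MeasurableSpace.invariants T] (rarelyVisiting T A) :=
  ⟨measurableSet_rarelyVisiting hT hA, preimage_rarelyVisiting⟩

variable {ν : Measure α} [IsFiniteMeasure ν]

theorem measure_inter_rarelyVisiting (hT : MeasurePreserving T ν ν) (hA : MeasurableSet A) :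
    ν (A ∩ rarelyVisiting T A) = 0 := by
  set B := rarelyVisiting T A
  have hf : Integrable (A.indicator (1 : α → ℝ)) ν := (integrable_const 1).indicator hA
  have hle : ∀ ε > (0 : ℝ), ν.real (A ∩ B) ≤ ε * ν.real B := by
    intro ε hε
    have h := setIntegral_le_mul_measureReal_of_birkhoffSum_lt hT hf
      (measurableSet_invariants_rarelyVisiting hT.measurable hA) (c := ε) fun x hx => ?_
    · rwa [integral_indicator_one hA, measureReal_restrict_apply hA] at h
    · obtain ⟨n, hn, hn0⟩ := ((hx ε hε).and_eventually (eventually_gt_atTop 0)).exists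
      rw [birkhoffAverage, smul_eq_mul, inv_mul_lt_iff₀ (Nat.cast_pos.2 hn0)] at hn
      exact ⟨n, hn⟩
  have hlim : Tendsto (fun ε : ℝ => ε * ν.real B) (𝓝[>] 0) (𝓝 0) := by
    simpa only [zero_mul] using ((continuous_mul_const (ν.real B)).tendsto 0).mono_left
      nhdsWithin_le_nhds
  have hnonpos : ν.real (A ∩ B) ≤ 0 := ge_of_tendsto hlim (eventually_mem_nhdsWithin.mono hle)
  exact (measureReal_eq_zero_iff).1 (hnonpos.antisymm measureReal_nonneg)

theorem ae_exists_forall_birkhoffSum_le (hT : MeasurePreserving T ν ν) {ι : Type*} {l : Filter ι}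
    [l.NeBot] {A : ι → Set α} (hA : ∀ v, MeasurableSet (A v))
    (hlim : Tendsto (fun v => ν.real (A v)) l (𝓝 0)) {ε : ℝ} (hε : 0 < ε) :
    ∀ᵐ x ∂ν, ∃ v, ∀ n : ℕ, birkhoffSum T ((A v).indicator (1 : α → ℝ)) n x ≤ n * ε := by
  rw [ae_iff]
  set F := {x | ¬∃ v, ∀ n : ℕ, birkhoffSum T ((A v).indicator (1 : α → ℝ)) n x ≤ n * ε}
  have hle : ∀ v, ε * ν.real F ≤ ν.real (A v) := by
    intro v
    set E := {x | ∃ n : ℕ, n * ε < birkhoffSum T ((A v).indicator (1 : α → ℝ)) n x}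
    have hFE : F ⊆ E := fun x hx =>
      (not_forall.1 (not_exists.1 hx v)).imp fun _ => not_le.1
    calc ε * ν.real F ≤ ε * ν.real E := mul_le_mul_of_nonneg_left (measureReal_mono hFE) hε.le
      _ ≤ ∫ x in E, (A v).indicator 1 x ∂ν :=
        mul_measureReal_exists_lt_birkhoffSum_le hT ((integrable_const 1).indicator (hA v)) ε
      _ = ν.real (A v ∩ E) := by
        rw [integral_indicator_one (hA v), measureReal_restrict_apply (hA v)]
      _ ≤ ν.real (A v) := measureReal_mono Set.inter_subset_left
  have hnonpos : ν.real F ≤ 0 := nonpos_of_mul_nonpos_right (ge_of_tendsto' hlim hle) hε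
  exact (measureReal_eq_zero_iff).1 (hnonpos.antisymm measureReal_nonneg)

theorem tendsto_measureReal_lt_atTop {f : α → ℝ} (hf : Measurable f) :
    Tendsto (fun v : ℝ => ν.real {x | v < f x}) atTop (𝓝 0) := by
  have hempty : ⋂ v : ℝ, {x | v < f x} = ∅ :=
    Set.eq_empty_of_forall_notMem fun x hx => lt_irrefl (f x) (Set.mem_iInter.1 hx (f x))
  have h := tendsto_measure_iInter_atTop (μ := ν) (s := fun v : ℝ => {x | v < f x})
    (fun v => (measurableSet_lt measurable_const hf).nullMeasurableSet)
    (fun u v huv x hx => huv.trans_lt hx) ⟨0, measure_ne_top _ _⟩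
  rw [hempty, measure_empty] at h
  exact (ENNReal.tendsto_toReal ENNReal.zero_ne_top).comp h

end Visits

section OrderStatistics

variable {x : ℕ → ℝ}

theorem orderStat_le_iff {k n : ℕ} (hk : 1 ≤ k) (hkn : k ≤ n) {v : ℝ} :
    orderStat x k n ≤ v ↔ k ≤ Nat.count (fun i => x i ≤ v) n := by
  set f : Fin n → ℝ := fun i => x i
  have hcount : (Finset.univ.filter fun i => (f ∘ Tuple.sort f) i ≤ v).card =
      Nat.count (fun i => x i ≤ v) n := by
    rw [Nat.count_eq_card_filter_range, Finset.card_filter, Finset.card_filter,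
      ← Fin.sum_univ_eq_sum_range (fun i => if x i ≤ v then 1 else 0) n]
    exact Equiv.sum_comp (Tuple.sort f) fun i => if f i ≤ v then 1 else 0
  rw [orderStat, dif_pos ⟨hk, hkn⟩, ← hcount]
  refine (Tuple.lt_card_le_iff_apply_le_of_monotone (Tuple.monotone_sort f)).symm.trans ?_
  exact (Nat.sub_lt_iff_lt_add hk).trans Nat.lt_add_one_iff

theorem lt_orderStat_iff {k n : ℕ} (hk : 1 ≤ k) (hkn : k ≤ n) {v : ℝ} :
    v < orderStat x k n ↔ n < Nat.count (fun i => v < x i) n + k := by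
  have hcount : Nat.count (fun i => x i ≤ v) n + Nat.count (fun i => v < x i) n = n := by
    simpa only [Nat.count_eq_card_filter_range, not_le, Finset.card_range] using
      Finset.card_filter_add_card_filter_not (s := Finset.range n) fun i => x i ≤ v
  rw [← not_le, orderStat_le_iff hk hkn]
  omega

theorem tendsto_orderStat_atTop {k : ℕ → ℕ} (hk : IsExtremeOrIntermediate k)
    (h : ∀ v, ∃ ε > (0 : ℝ), ∀ᶠ n : ℕ in atTop,
      n * ε ≤ (Nat.count (fun i => v < x i) n : ℝ)) :
    Tendsto (fun n => orderStat x (k n) n) atTop atTop := by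
  refine tendsto_atTop.2 fun v => ?_
  obtain ⟨ε, hε, hcount⟩ := h v
  have hkε : ∀ᶠ n : ℕ in atTop, 1 - ε < (k n : ℝ) / n :=
    hk.tendsto.eventually_const_lt (sub_lt_self 1 hε)
  filter_upwards [hcount, hkε, eventually_ge_atTop 1] with n hn hkn hn1
  obtain ⟨hk1, hk2⟩ := hk.mem n hn1
  refine ((lt_orderStat_iff hk1 hk2).2 ?_).le
  rw [lt_div_iff₀ (Nat.cast_pos.2 hn1)] at hkn
  rify
  linarith

theorem abs_nearSum_le {k n : ℕ} {a v : ℝ} (hM : 0 ≤ orderStat x k n) (hv : -v ≤ orderStat x k n)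
    (hva : v + a ≤ orderStat x k n) :
    |nearSum x k n a| ≤ Nat.count (fun i => v < x i) n * orderStat x k n := by
  rw [nearSum, Nat.count_eq_card_filter_range, ← nsmul_eq_mul, ← Finset.sum_const,
    Finset.sum_filter]
  set M := orderStat x k n
  refine (Finset.abs_sum_le_sum_abs _ _).trans (Finset.sum_le_sum fun i _ => ?_)
  by_cases hi : x i ∈ Set.Ioo (M - a) M
  · have hvi : v < x i := by linarith [hi.1]
    rw [Set.indicator_of_mem hi, if_pos hvi]
    exact abs_le.2 ⟨by linarith, hi.2.le⟩
  · rw [Set.indicator_of_notMem hi, abs_zero]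
    split_ifs <;> simp only [hM, le_refl]

theorem nearSum_isLittleO {k : ℕ → ℕ} {a : ℝ}
    (hM : Tendsto (fun n => orderStat x (k n) n) atTop atTop)
    (h : ∀ ε > (0 : ℝ), ∃ v, ∀ᶠ n : ℕ in atTop,
      (Nat.count (fun i => v < x i) n : ℝ) ≤ n * ε) :
    (fun n => nearSum x (k n) n a) =o[atTop] fun n => (n : ℝ) * orderStat x (k n) n := by
  refine Asymptotics.isLittleO_iff.2 fun ε hε => ?_
  obtain ⟨v, hv⟩ := h ε hε
  filter_upwards [hv, hM.eventually_ge_atTop 0, hM.eventually_ge_atTop (-v),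
    hM.eventually_ge_atTop (v + a)] with n hn hM0 hMv hMa
  rw [Real.norm_eq_abs, Real.norm_of_nonneg (by positivity)]
  calc |nearSum x (k n) n a| ≤ Nat.count (fun i => v < x i) n * orderStat x (k n) n :=
        abs_nearSum_le hM0 hMv hMa
    _ ≤ n * ε * orderStat x (k n) n := by gcongr
    _ = ε * (n * orderStat x (k n) n) := by ring

end OrderStatistics

section StationarySequences

/-- The shift on the space of real sequences. It turns stationarity of a sequence into invariance
of its law. -/
def pathShift (x : ℕ → ℝ) : ℕ → ℝ := fun i => x (i + 1)

theorem measurable_pathShift : Measurable pathShift :=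
  measurable_pi_lambda _ fun i => measurable_pi_apply (i + 1)

theorem iterate_pathShift (m : ℕ) (x : ℕ → ℝ) : pathShift^[m] x = fun i => x (m + i) := by
  induction m generalizing x with
  | zero => simp only [Function.iterate_zero, id, zero_add]
  | succ m ih =>
    rw [Function.iterate_succ_apply, ih]
    exact funext fun i => congrArg x (by ring)

theorem birkhoffSum_pathShift_indicator_lt (v : ℝ) (n : ℕ) (x : ℕ → ℝ) :
    birkhoffSum pathShift ({y : ℕ → ℝ | v < y 0}.indicator (1 : (ℕ → ℝ) → ℝ)) n x =
      Nat.count (fun i => v < x i) n := by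
  rw [Nat.count_eq_card_filter_range, Finset.card_filter, Nat.cast_sum]
  refine Finset.sum_congr rfl fun i _ => ?_
  simp [iterate_pathShift, Set.indicator_apply]

theorem measurableSet_lt_apply_zero (v : ℝ) : MeasurableSet {y : ℕ → ℝ | v < y 0} :=
  measurableSet_lt measurable_const (measurable_pi_apply 0)

theorem ae_forall_exists_forall_count_le {ν : Measure (ℕ → ℝ)} [IsFiniteMeasure ν]
    (hT : MeasurePreserving pathShift ν ν) :
    ∀ᵐ x ∂ν, ∀ ε > (0 : ℝ), ∃ v, ∀ n : ℕ, (Nat.count (fun i => v < x i) n : ℝ) ≤ n * ε := by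
  have h : ∀ m : ℕ, ∀ᵐ x ∂ν, ∃ v : ℝ, ∀ n : ℕ,
      (Nat.count (fun i => v < x i) n : ℝ) ≤ n * (1 / ((m : ℝ) + 1)) := fun m => by
    simpa only [birkhoffSum_pathShift_indicator_lt] using
      ae_exists_forall_birkhoffSum_le hT measurableSet_lt_apply_zero
        (tendsto_measureReal_lt_atTop (measurable_pi_apply 0)) Nat.one_div_pos_of_nat
  filter_upwards [ae_all_iff.2 h] with x hx ε hε
  obtain ⟨m, hm⟩ := exists_nat_one_div_lt hε
  obtain ⟨v, hv⟩ := hx m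
  exact ⟨v, fun n => (hv n).trans (by gcongr)⟩

variable {Ω : Type*} {mΩ : MeasurableSpace Ω} {μ : Measure Ω} {X : ℕ → Ω → ℝ}

theorem StrictlyStationary.measurePreserving_pathShift (hstat : StrictlyStationary μ X)
    (hX : ∀ i, Measurable (X i)) :
    MeasurePreserving pathShift (μ.map fun ω i => X i ω) (μ.map fun ω i => X i ω) := by
  refine ⟨measurable_pathShift, ?_⟩
  rw [Measure.map_map measurable_pathShift (measurable_pi_lambda _ hX)]
  exact hstat 1

theorem measurableSet_invariantSigma_preimage (X : ℕ → Ω → ℝ) {B : Set (ℕ → ℝ)}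
    (hB : MeasurableSet[MeasurableSpace.invariants pathShift] B) :
    MeasurableSet[invariantSigma X] {ω | (fun i => X i ω) ∈ B} := by
  refine ⟨B, hB.1, fun i => Set.ext fun ω => ?_⟩
  have hBi : pathShift^[i] ⁻¹' B = B := (MeasurableSpace.le_invariants_iterate pathShift i B hB).2
  rw [Set.mem_ofPred_eq, Set.mem_ofPred_eq, ← iterate_pathShift i fun j => X j ω]
  exact (Set.ext_iff.1 hBi _).symm

variable [IsFiniteMeasure μ]

theorem IsCondRightEndpoint.ae_le_of_ae_le {G : MeasurableSpace Ω} {Y : Ω → ℝ} {Q Q' : Ω → EReal}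
    (hQ : IsCondRightEndpoint μ G Y Q) (hG : G ≤ mΩ) (hQ' : Measurable[G] Q')
    (h : ∀ᵐ ω ∂μ, (Y ω : EReal) ≤ Q' ω) : Q ≤ᵐ[μ] Q' := by
  have hind : ({ω | (Y ω : EReal) ≤ Q' ω}.indicator fun _ => (1 : ℝ)) =ᵐ[μ] fun _ => 1 :=
    h.mono fun ω hω => Set.indicator_of_mem (s := {ω | (Y ω : EReal) ≤ Q' ω}) hω _
  refine hQ.least Q' hQ' ((condExp_congr_ae hind).trans ?_)
  rw [condExp_const hG]

theorem IsCondRightEndpoint.ae_mem_imp_le {G : MeasurableSpace Ω} {Y : Ω → ℝ} {Q : Ω → EReal}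
    (hQ : IsCondRightEndpoint μ G Y Q) (hG : G ≤ mΩ) {A : Set Ω} (hA : MeasurableSet[G] A)
    {v : EReal} (h : ∀ᵐ ω ∂μ, ω ∈ A → (Y ω : EReal) ≤ v) : ∀ᵐ ω ∂μ, ω ∈ A → Q ω ≤ v := by
  classical
  have hle := hQ.ae_le_of_ae_le hG (Q' := A.piecewise (fun _ => v) fun _ => ⊤)
    (Measurable.piecewise hA measurable_const measurable_const) <| h.mono fun ω hω => by
      by_cases hωA : ω ∈ A <;> simp [hωA, hω]
  filter_upwards [hle] with ω hω hωA
  simpa only [Set.piecewise_eq_of_mem _ _ _ hωA] using hω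

theorem ae_notMem_rarelyVisiting (hX : ∀ i, Measurable (X i)) (hstat : StrictlyStationary μ X)
    {γ : Ω → EReal} (hγ : IsCondRightEndpoint μ (invariantSigma X) (X 0) γ) (v : ℝ) :
    ∀ᵐ ω ∂μ, γ ω = ⊤ → (fun i => X i ω) ∉ rarelyVisiting pathShift {y | v < y 0} := by
  have hA := measurableSet_lt_apply_zero v
  have hB := measurableSet_invariants_rarelyVisiting measurable_pathShift hA
  have hpath : Measurable fun ω i => X i ω := measurable_pi_lambda _ hX
  have hnull := measure_inter_rarelyVisiting (hstat.measurePreserving_pathShift hX) hA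
  rw [Measure.map_apply hpath (hA.inter hB.1)] at hnull
  have hbound : ∀ᵐ ω ∂μ, (fun i => X i ω) ∈ rarelyVisiting pathShift {y | v < y 0} →
      (X 0 ω : EReal) ≤ v := by
    filter_upwards [measure_eq_zero_iff_ae_notMem.1 hnull] with ω hω hωB
    exact EReal.coe_le_coe_iff.2 (not_lt.1 fun hlt => hω ⟨hlt, hωB⟩)
  filter_upwards [hγ.ae_mem_imp_le (invariantSigma_le hX)
    (measurableSet_invariantSigma_preimage X hB) hbound] with ω hω htop hωB
  exact EReal.coe_ne_top v (top_le_iff.1 (htop ▸ hω hωB))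

theorem ae_tendsto_orderStat_atTop (hX : ∀ i, Measurable (X i)) (hstat : StrictlyStationary μ X)
    {k : ℕ → ℕ} (hk : IsExtremeOrIntermediate k) {γ : Ω → EReal}
    (hγ : IsCondRightEndpoint μ (invariantSigma X) (X 0) γ) :
    ∀ᵐ ω ∂μ, γ ω = ⊤ → Tendsto (fun n => orderStat (fun i => X i ω) (k n) n) atTop atTop := by
  -- Countably many levels suffice, because lowering the level only increases the count.
  filter_upwards [ae_all_iff.2 fun m : ℕ => ae_notMem_rarelyVisiting hX hstat hγ m] with ω hω htop
  refine tendsto_orderStat_atTop hk fun v => ?_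
  obtain ⟨m, hvm⟩ := exists_nat_ge v
  obtain ⟨ε, hε, h⟩ :=
    exists_eventually_le_birkhoffSum_of_notMem_rarelyVisiting (hω m htop)
  refine ⟨ε, hε, h.mono fun n hn => ?_⟩
  rw [birkhoffSum_pathShift_indicator_lt] at hn
  exact hn.trans (Nat.cast_le.2 (Nat.count_mono_left fun i _ hi => hvm.trans_lt hi))

theorem ae_nearSum_isLittleO (hX : ∀ i, Measurable (X i)) (hstat : StrictlyStationary μ X)
    {k : ℕ → ℕ} (hk : IsExtremeOrIntermediate k) (a : ℝ) {γ : Ω → EReal}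
    (hγ : IsCondRightEndpoint μ (invariantSigma X) (X 0) γ) :
    ∀ᵐ ω ∂μ, γ ω = ⊤ → (fun n => nearSum (fun i => X i ω) (k n) n a) =o[atTop]
      fun n => (n : ℝ) * orderStat (fun i => X i ω) (k n) n := by
  have hcount := ae_of_ae_map (measurable_pi_lambda _ hX).aemeasurable
    (ae_forall_exists_forall_count_le (hstat.measurePreserving_pathShift hX))
  filter_upwards [ae_tendsto_orderStat_atTop hX hstat hk hγ, hcount] with ω hM hω htop
  exact nearSum_isLittleO (hM htop) fun ε hε => (hω ε hε).imp fun v hv => .of_forall hv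

end StationarySequences

theorem tendsto_atTop_of_tendsto_natCast_div {ι : Type*} {l : Filter ι} {N : ι → ℕ} {c : ι → ℝ}
    {z : ℝ} (hc : Tendsto c l atTop) (hz : 0 < z)
    (hN : Tendsto (fun t => (N t : ℝ) / c t) l (𝓝 z)) : Tendsto N l atTop := by
  refine tendsto_natCast_atTop_iff.1 ((hN.pos_mul_atTop hz hc).congr' ?_)
  filter_upwards [hc.eventually_gt_atTop 0] with t ht
  exact div_mul_cancel₀ _ ht.ne'

theorem isBigO_natCast_of_tendsto_div {ι : Type*} {l : Filter ι} {N : ι → ℕ} {c : ι → ℝ} {z : ℝ}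
    (hc : Tendsto c l atTop) (hN : Tendsto (fun t => (N t : ℝ) / c t) l (𝓝 z)) :
    (fun t => (N t : ℝ)) =O[l] c :=
  Asymptotics.isBigO_of_div_tendsto_nhds
    ((hc.eventually_gt_atTop 0).mono fun _ ht h0 => absurd h0 ht.ne') z hN

end NearMax

open NearMax in
theorem theorem4p4_general {Ω : Type*} {mΩ : MeasurableSpace Ω} {μ : Measure Ω}
    [IsFiniteMeasure μ] {X : ℕ → Ω → ℝ} (hX : ∀ i, Measurable (X i))
    (hstat : StrictlyStationary μ X) {k : ℕ → ℕ} (hk : IsExtremeOrIntermediate k) (a : ℝ)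
    {γ : Ω → EReal} (hγ : IsCondRightEndpoint μ (invariantSigma X) (X 0) γ) :
    ∀ᵐ ω ∂μ, γ ω = ⊤ → ∀ {ι : Type*} {l : Filter ι} {N : ι → ℕ} {c : ι → ℝ}, Tendsto N l atTop →
      (fun t => (N t : ℝ)) =O[l] c →
      (∀ᶠ t in l, 1 ≤ N t ∧ orderStat (fun i => X i ω) (k (N t)) (N t) ≠ 0) ∧
      Tendsto (fun t => nearSum (fun i => X i ω) (k (N t)) (N t) a /
        (c t * orderStat (fun i => X i ω) (k (N t)) (N t))) l (𝓝 0) := by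
  filter_upwards [ae_tendsto_orderStat_atTop hX hstat hk hγ, ae_nearSum_isLittleO hX hstat hk a hγ]
    with ω hM hS htop ι l N c hN hc
  refine ⟨(hN.eventually_ge_atTop 1).and (((hM htop).comp hN).eventually_ne_atTop 0), ?_⟩
  have hS' := (hS htop).comp_tendsto hN
  exact (hS'.trans_isBigO (hc.mul (Asymptotics.isBigO_refl _ l))).tendsto_div_nhds_zero

theorem theorem4p4 {Ω : Type*} {mΩ : MeasurableSpace Ω} (μ : Measure Ω) [IsProbabilityMeasure μ]
    (X : ℕ → Ω → ℝ) (hX : ∀ i, Measurable (X i)) (hstat : NearMax.StrictlyStationary μ X)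
    (k : ℕ → ℕ) (hk : NearMax.IsExtremeOrIntermediate k)
    (a : ℝ) (ha : 0 < a)
    (γ : Ω → EReal) (hγ : NearMax.IsCondRightEndpoint μ (NearMax.invariantSigma X) (X 0) γ)
    (hγ_top : ∀ᵐ ω ∂μ, γ ω = ⊤) :
    -- deterministic sample size: the quotients are eventually defined, and tend to zero
    (∀ᵐ ω ∂μ,
      (∀ᶠ n : ℕ in atTop, NearMax.orderStat (fun i => X i ω) (k n) n ≠ 0) ∧
      Tendsto (fun n : ℕ =>
          NearMax.nearSum (fun i => X i ω) (k n) n a /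
            ((n : ℝ) * NearMax.orderStat (fun i => X i ω) (k n) n))
        atTop (𝓝 0)) ∧
    -- random sample size
    (∀ (N : ℝ≥0 → Ω → ℕ) (Z : Ω → ℝ) (c : ℝ≥0 → ℝ), NearMax.ConditionA μ N Z c →
      (∀ᵐ ω ∂μ, Tendsto (fun t : ℝ≥0 => (N t ω : ℝ) / c t) atTop (𝓝 (Z ω))) →
      ∀ᵐ ω ∂μ,
        (∀ᶠ t : ℝ≥0 in atTop,
          1 ≤ N t ω ∧ NearMax.orderStat (fun i => X i ω) (k (N t ω)) (N t ω) ≠ 0) ∧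
        Tendsto (fun t : ℝ≥0 =>
            NearMax.nearSum (fun i => X i ω) (k (N t ω)) (N t ω) a /
              (c t * NearMax.orderStat (fun i => X i ω) (k (N t ω)) (N t ω)))
          atTop (𝓝 0)) := by
  have h := hγ_top.mp (theorem4p4_general hX hstat hk a hγ)
  refine ⟨h.mono fun ω hω => (hω tendsto_id (Asymptotics.isBigO_refl _ _)).imp_left
    fun hne => hne.mono fun n => And.right, fun N Z c hA hN => ?_⟩
  filter_upwards [h, hN, hA.Z_pos] with ω hω hNω hZ
  exact hω (NearMax.tendsto_atTop_of_tendsto_natCast_div hA.c_tendsto hZ hNω)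
    (NearMax.isBigO_natCast_of_tendsto_div hA.c_tendsto hNω)
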